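/- Let $U_1,\dots,U_n\in SU(d)$. Let $\mathfrak{su}(d)$ be the real vector space of traceless antihermitian $d\times d$ matrices with inner product $(X|Y)=-\tfrac12\operatorname{tr}XY$, and for $U\in SU(d)$ let $\mathrm{Ad}_U$ be the real $(d^2-1)\times(d^2-1)$ matrix of $X\mapsto UXU^{-1}$ in a fixed orthonormal basis of $\mathfrak{su}(d)$. With $\|A\|=\sqrt{\operatorname{tr}AA^\dagger}$, let $\mathcal B$ be the set of $U\in SU(d)$ such that $\|U-\alpha I\|\le 1/\sqrt2$ for some $\alpha\in\mathbb C$ with $\alpha^d=1$, and let $Z(SU(d))=\{\alpha I:\alpha^d=1\}$. For $U\in SU(d)$ let $n_U$ be the smallest integer $n\ge1$ with $U^n\in\mathcal B$, and let $N_{SU(d)}=\max_{U\in SU(d)}n_U$. The spectrum of $U\in SU(d)$ is called exceptional if $U\notin\mathcal B\setminus Z(SU(d))$ and there are an integer $1\le n\le N_{SU(d)}$ and $\alpha\in\mathbb C$ with $\alpha^d=1$ such that every eigenvalue $\lambda$ of $U$ satisfies $\lambda^n=\alpha$. (In particular central elements have exceptional spectrum.) Assume that the only real $(d^2-1)\times(d^2-1)$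 matrices commuting with all of $\mathrm{Ad}_{U_1},\dots,\mathrm{Ad}_{U_n}$ are the matrices $\lambda I$, $\lambda\in\mathbb R$, and that at least one $U_i$ has a nonexceptional spectrum. Then the set $\langle U_1,\dots,U_n\rangle=\{U_{i_1}\cdots U_{i_m}: m\ge1,\ 1\le i_j\le n\}$ is dense in $SU(d)$, that is, $\overline{\langle U_1,\dots,U_n\rangle}=SU(d)$; in particular the group generated by $U_1,\dots,U_n$ is dense in $SU(d)$. -/

import Mathlib

open Matrix

/-- The special unitary group `SU(d)`, as a subtype of the complex `d × d` matrices. -/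
abbrev SU (d : ℕ) : Type := Matrix.specialUnitaryGroup (Fin d) ℂ

/-- `𝔰𝔲(d)`: the real vector space of antihermitian traceless `d × d` matrices. -/
def su (d : ℕ) : Submodule ℝ (Matrix (Fin d) (Fin d) ℂ) where
  carrier := {X | Xᴴ = -X ∧ X.trace = 0}
  add_mem' := by
    rintro X Y ⟨hX, hX'⟩ ⟨hY, hY'⟩
    refine ⟨?_, ?_⟩
    · rw [conjTranspose_add, hX, hY, neg_add]
    · rw [trace_add, hX', hY', add_zero]
  zero_mem' := by simp
  smul_mem' := by
    rintro c X ⟨hX, hX'⟩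
    refine ⟨?_, ?_⟩
    · rw [conjTranspose_smul, hX, star_trivial, smul_neg]
    · rw [trace_smul, hX', smul_zero]

/-- The inner product `(X|Y) = -½ tr XY` on `𝔰𝔲(d)` (the trace is real there). -/
noncomputable def suInner {d : ℕ} (X Y : su d) : ℝ :=
  -(1 / 2 : ℝ) * (trace ((X : Matrix (Fin d) (Fin d) ℂ) * (Y : Matrix (Fin d) (Fin d) ℂ))).re

/-- The operator `Ad_U X = U X U⁻¹` on `𝔰𝔲(d)`. -/
def Ad {d : ℕ} (U : SU d) : su d →ₗ[ℝ] su d where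
  toFun X := ⟨(U : Matrix (Fin d) (Fin d) ℂ) * X * ((U⁻¹ : SU d) : Matrix (Fin d) (Fin d) ℂ), by
    have hinv : ((U⁻¹ : SU d) : Matrix (Fin d) (Fin d) ℂ)
        = (U : Matrix (Fin d) (Fin d) ℂ)ᴴ := rfl
    have hU : (U : Matrix (Fin d) (Fin d) ℂ)ᴴ * (U : Matrix (Fin d) (Fin d) ℂ) = 1 :=
      (mem_specialUnitaryGroup_iff.1 U.2).1.1
    obtain ⟨hX, hX'⟩ := X.2
    refine ⟨?_, ?_⟩
    · rw [hinv, conjTranspose_mul, conjTranspose_mul, hX, conjTranspose_conjTranspose]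
      simp [mul_assoc]
    · rw [hinv, trace_mul_comm, ← mul_assoc, hU, one_mul, hX']⟩
  map_add' X Y := by
    ext1
    simp [mul_add, add_mul]
  map_smul' c X := by
    ext1
    simp

/-- The real matrix of `Ad_U` in a basis of `𝔰𝔲(d)`. -/
noncomputable def AdMatrix {d : ℕ} (X : Module.Basis (Fin (d ^ 2 - 1)) ℝ (su d)) (U : SU d) :
    Matrix (Fin (d ^ 2 - 1)) (Fin (d ^ 2 - 1)) ℝ :=
  LinearMap.toMatrix X X (Ad U)

/-- The Hilbert–Schmidt norm `‖A‖ = √(tr A A†)`. -/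
noncomputable def hsNorm {d : ℕ} (A : Matrix (Fin d) (Fin d) ℂ) : ℝ :=
  Real.sqrt (trace (A * Aᴴ)).re

/-- The ball `B_α = {U ∈ SU(d) : ‖U - αI‖ ≤ 1/√2}`. -/
def ballAt (d : ℕ) (α : ℂ) : Set (SU d) :=
  {U | hsNorm ((U : Matrix (Fin d) (Fin d) ℂ) - α • (1 : Matrix (Fin d) (Fin d) ℂ))
    ≤ 1 / Real.sqrt 2}

/-- `𝓑`, the union of the balls `B_α` over all `α` with `α ^ d = 1`. -/
def ballUnion (d : ℕ) : Set (SU d) := {U | ∃ α : ℂ, α ^ d = 1 ∧ U ∈ ballAt d α}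

/-- The centre `Z(SU(d)) = {αI : α ^ d = 1}`. -/
def centreSU (d : ℕ) : Set (SU d) :=
  {U | ∃ α : ℂ, α ^ d = 1 ∧
    (U : Matrix (Fin d) (Fin d) ℂ) = α • (1 : Matrix (Fin d) (Fin d) ℂ)}

/-- `n_U`: the smallest `n ≥ 1` such that `U ^ n` lies in `𝓑`. -/
noncomputable def returnTime {d : ℕ} (U : SU d) : ℕ :=
  sInf {n : ℕ | 1 ≤ n ∧ U ^ n ∈ ballUnion d}

/-- `N_{SU(d)} = max_U n_U`. -/
noncomputable def maxReturnTime (d : ℕ) : ℕ :=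
  sSup (Set.range fun U : SU d => returnTime U)

/-- The spectrum of `U` is exceptional: `U` is not a noncentral element of `𝓑`, and for some
`1 ≤ n ≤ N_{SU(d)}` and some `α` with `α ^ d = 1` all eigenvalues of `U` are `n`-th roots of `α`.
Central elements have exceptional spectrum (take `n = 1`). -/
def HasExceptionalSpectrum {d : ℕ} (U : SU d) : Prop :=
  U ∉ ballUnion d \ centreSU d ∧
    ∃ n : ℕ, 1 ≤ n ∧ n ≤ maxReturnTime d ∧ ∃ α : ℂ, α ^ d = 1 ∧
      ∀ z ∈ spectrum ℂ (U : Matrix (Fin d) (Fin d) ℂ), z ^ n = α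

/-! Let `H` be the closure of the semigroup generated by the `U i`. In a compact group a closed
subsemigroup is a subgroup, because the powers of `x` accumulate at `x⁻¹`; so `H` is a closed
subgroup. An `Ad`-invariant subspace of `𝔰𝔲(d)` has an invariant orthogonal projection, so the
hypothesis on the commutant says that `Ad` is irreducible on `H`
(`eq_bot_or_eq_top_of_Ad_invariant`). The nonexceptional `U i` has a power that is a noncentral
element of the balls (`exists_pow_mem_ballUnion_diff`): return times are bounded by compactness, so
the first return happens within the range of exponents covered by the definition.

Such an `H` cannot be finite (`mem_centreSU_of_finite`). If `g` lies in a ball, then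
`‖g h g⁻¹ h⁻¹ - 1‖ < ‖h - β‖` for every scalar `β` different from `h` (`hsNorm_commutator_lt`):
in an eigenbasis of `g`, taking the commutator with `g` multiplies matrix entries by differences of
eigenvalues, all less than `1` in absolute value. Hence a noncentral `h ∈ H` at minimal distance
from the scalars commutes with all elements of `H` in the balls, in particular with its own
conjugates. The elements of `𝔰𝔲(d)` that commute with all conjugates of `h` form an invariant
subspace; it contains the traceless antihermitian parts of `h` and `i h`, so it is not zero, and it
is not everything because `h` is not a scalar. This contradicts irreducibility.

So `H` is infinite, and its elements accumulate at `1`. A limit of their directions is tangent to a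
one-parameter subgroup of `H` (`isOneParam_of_tendsto`), so the Lie algebra of `H` is a nonzero
invariant subspace of `𝔰𝔲(d)`, hence all of it. As the exponential map of `SU(d)` is surjective,
`H = SU(d)`. -/

/-! ### The topological group `SU(d)` -/

instance SU.instIsTopologicalGroup (d : ℕ) : IsTopologicalGroup (SU d) where
  continuous_inv := by
    refine Continuous.subtype_mk ?_ _
    exact continuous_subtype_val.matrix_conjTranspose

instance SU.instCompactSpace (d : ℕ) : CompactSpace (SU d) := by
  refine isCompact_iff_compactSpace.1 ?_
  have hK : IsCompact (Set.univ.pi fun _ : Fin d => Set.univ.pi fun _ : Fin d =>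
      Metric.closedBall (0 : ℂ) 1) :=
    isCompact_univ_pi fun _ => isCompact_univ_pi fun _ => isCompact_closedBall 0 1
  refine hK.of_isClosed_subset ?_ fun A hA i _ j _ => ?_
  · have : ((specialUnitaryGroup (Fin d) ℂ : Submonoid _) : Set (Matrix (Fin d) (Fin d) ℂ)) =
        {A | A * Aᴴ = 1} ∩ {A | A.det = 1} := by
      ext A
      exact mem_specialUnitaryGroup_iff.trans (and_congr_left fun _ => mem_unitaryGroup_iff)
    rw [this]
    exact (isClosed_eq (continuous_id.matrix_mul continuous_id.matrix_conjTranspose)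
      continuous_const).inter (isClosed_eq continuous_id.matrix_det continuous_const)
  · rw [mem_closedBall_zero_iff]
    exact entry_norm_bound_of_unitary (mem_specialUnitaryGroup_iff.1 hA).1 i j

namespace SU

variable {d : ℕ}

lemma coe_inv (U : SU d) :
    ((U⁻¹ : SU d) : Matrix (Fin d) (Fin d) ℂ) = (U : Matrix (Fin d) (Fin d) ℂ)ᴴ := rfl

lemma conjTranspose_mul_self (U : SU d) :
    (U : Matrix (Fin d) (Fin d) ℂ)ᴴ * (U : Matrix (Fin d) (Fin d) ℂ) = 1 :=
  (mem_specialUnitaryGroup_iff.1 U.2).1.1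

lemma mul_conjTranspose_self (U : SU d) :
    (U : Matrix (Fin d) (Fin d) ℂ) * (U : Matrix (Fin d) (Fin d) ℂ)ᴴ = 1 :=
  (mem_specialUnitaryGroup_iff.1 U.2).1.2

lemma mem_unitary (U : SU d) :
    (U : Matrix (Fin d) (Fin d) ℂ) ∈ unitary (Matrix (Fin d) (Fin d) ℂ) :=
  (mem_specialUnitaryGroup_iff.1 U.2).1

lemma det_eq_one (U : SU d) : (U : Matrix (Fin d) (Fin d) ℂ).det = 1 :=
  (mem_specialUnitaryGroup_iff.1 U.2).2

/-- A scalar matrix in `SU(d)` is central: its scalar is a `d`-th root of unity. -/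
lemma mem_centreSU_of_eq_smul {U : SU d} {a : ℂ}
    (h : (U : Matrix (Fin d) (Fin d) ℂ) = a • (1 : Matrix (Fin d) (Fin d) ℂ)) :
    U ∈ centreSU d := by
  refine ⟨a, ?_, h⟩
  have := U.det_eq_one
  rwa [h, det_smul, det_one, mul_one, Fintype.card_fin] at this

end SU

/-! ### The Hilbert–Schmidt norm -/

section HilbertSchmidt

variable {d : ℕ}

lemma trace_mul_conjTranspose_re (A : Matrix (Fin d) (Fin d) ℂ) :
    (trace (A * Aᴴ)).re = ∑ i, ∑ j, ‖A i j‖ ^ 2 := by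
  simp only [trace, diag_apply, mul_apply, conjTranspose_apply, Complex.re_sum]
  refine Finset.sum_congr rfl fun i _ => Finset.sum_congr rfl fun j _ => ?_
  rw [Complex.star_def, Complex.mul_conj, Complex.ofReal_re, Complex.normSq_eq_norm_sq]

lemma hsNorm_nonneg (A : Matrix (Fin d) (Fin d) ℂ) : 0 ≤ hsNorm A := Real.sqrt_nonneg _

lemma hsNorm_sq (A : Matrix (Fin d) (Fin d) ℂ) : hsNorm A ^ 2 = ∑ i, ∑ j, ‖A i j‖ ^ 2 := by
  rw [hsNorm, trace_mul_conjTranspose_re, Real.sq_sqrt]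
  positivity

lemma hsNorm_sq_eq_trace (A : Matrix (Fin d) (Fin d) ℂ) :
    hsNorm A ^ 2 = (trace (A * Aᴴ)).re := by
  rw [hsNorm_sq, trace_mul_conjTranspose_re]

lemma hsNorm_pos {A : Matrix (Fin d) (Fin d) ℂ} (hA : A ≠ 0) : 0 < hsNorm A := by
  refine (hsNorm_nonneg A).lt_of_ne' fun h => hA ?_
  have h2 := hsNorm_sq A
  rw [h, zero_pow two_ne_zero, eq_comm,
    Finset.sum_eq_zero_iff_of_nonneg fun i _ => by positivity] at h2
  ext i j
  have h3 := h2 i (Finset.mem_univ i)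
  rw [Finset.sum_eq_zero_iff_of_nonneg fun i _ => by positivity] at h3
  simpa using h3 j (Finset.mem_univ j)

lemma hsNorm_unitary_mul {V : Matrix (Fin d) (Fin d) ℂ} (hV : Vᴴ * V = 1)
    (A : Matrix (Fin d) (Fin d) ℂ) : hsNorm (V * A) = hsNorm A := by
  rw [hsNorm, hsNorm, conjTranspose_mul, mul_assoc, trace_mul_comm, ← mul_assoc,
    mul_assoc (A * Aᴴ), hV, mul_one]

lemma hsNorm_mul_unitary {V : Matrix (Fin d) (Fin d) ℂ} (hV : V * Vᴴ = 1)
    (A : Matrix (Fin d) (Fin d) ℂ) : hsNorm (A * V) = hsNorm A := by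
  rw [hsNorm, hsNorm, conjTranspose_mul, mul_assoc, ← mul_assoc V, hV, one_mul]

lemma continuous_hsNorm : Continuous (hsNorm (d := d)) := by
  unfold hsNorm
  fun_prop

end HilbertSchmidt

/-! ### Diagonalization of unitary and antihermitian matrices -/

section Diagonalization

variable {d : ℕ}

open scoped Matrix.Norms.L2Operator

lemma exists_diagonal_of_isHermitian {A : Matrix (Fin d) (Fin d) ℂ} (hA : A.IsHermitian) :
    ∃ V : Matrix (Fin d) (Fin d) ℂ, Vᴴ * V = 1 ∧ V * Vᴴ = 1 ∧
      ∃ θ : Fin d → ℝ, A = V * diagonal (fun i => (θ i : ℂ)) * Vᴴ := by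
  refine ⟨hA.eigenvectorUnitary, hA.eigenvectorUnitary.2.1, hA.eigenvectorUnitary.2.2,
    hA.eigenvalues, ?_⟩
  conv_lhs => rw [hA.spectral_theorem, Unitary.conjStarAlgAut_apply]
  rfl

lemma exp_unitary_conj_diagonal {V : Matrix (Fin d) (Fin d) ℂ} (hV : V * Vᴴ = 1)
    (v : Fin d → ℂ) :
    NormedSpace.exp (V * diagonal v * Vᴴ) = V * diagonal (fun i => Complex.exp (v i)) * Vᴴ := by
  have hi : V⁻¹ = Vᴴ := inv_eq_right_inv hV
  have hu : IsUnit V := ⟨⟨V, Vᴴ, hV, mul_eq_one_comm.1 hV⟩, rfl⟩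
  rw [← hi, exp_conj _ _ hu, exp_diagonal]
  congr 3
  ext i
  rw [Pi.coe_exp, Complex.exp_eq_exp_ℂ]

lemma exists_diagonal_of_mem_unitary {U : Matrix (Fin d) (Fin d) ℂ}
    (hU : U ∈ unitary (Matrix (Fin d) (Fin d) ℂ)) :
    ∃ V : Matrix (Fin d) (Fin d) ℂ, Vᴴ * V = 1 ∧ V * Vᴴ = 1 ∧
      ∃ θ : Fin d → ℝ, U = V * diagonal (fun i => Complex.exp (θ i * Complex.I)) * Vᴴ := by
  -- Only finitely many phases are eigenvalues, so after multiplication by a suitable phase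
  -- the number `-1` is no eigenvalue and the logarithm is available.
  obtain ⟨φ, hφ⟩ : ∃ φ : ℝ, Complex.exp (φ * Complex.I) ∉ spectrum ℂ (-U) := by
    by_contra! hall
    have hinj : Set.InjOn (fun φ : ℝ => Complex.exp (φ * Complex.I)) (Set.Ioo 0 1) := by
      intro x hx y hy hxy
      have harg : ∀ t ∈ Set.Ioo (0 : ℝ) 1, (Complex.exp (t * Complex.I)).arg = t := by
        intro t ht
        rw [Complex.exp_mul_I, Complex.arg_cos_add_sin_mul_I]
        exact ⟨by linarith [ht.1, Real.pi_pos], by linarith [ht.2, Real.pi_gt_three]⟩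
      rw [← harg x hx, ← harg y hy]
      exact congrArg Complex.arg hxy
    exact Set.infinite_of_injOn_mapsTo hinj (fun φ _ => hall φ) (Set.Ioo_infinite one_pos)
      (-U).finite_spectrum
  set z : ℂ := Complex.exp (φ * Complex.I) with hz
  have hzz : star z * z = 1 := by
    rw [hz, Complex.star_def, ← Complex.exp_conj, ← Complex.exp_add]
    simp
  have hW : star z • U ∈ unitary (Matrix (Fin d) (Fin d) ℂ) := by
    rw [Unitary.mem_iff, star_smul, star_star, smul_mul_smul_comm, smul_mul_smul_comm, hU.1, hU.2,
      mul_comm z, hzz, one_smul]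
    exact ⟨rfl, rfl⟩
  have hlt : ‖star z • U - 1‖ < 2 := by
    rw [Unitary.norm_sub_one_lt_two_iff hW]
    rw [spectrum.mem_iff, not_not] at hφ ⊢
    have hz0 : -star z ≠ 0 := neg_ne_zero.2 (left_ne_zero_of_mul_eq_one hzz)
    have h := hφ.smul (Units.mk0 _ hz0)
    convert h using 1
    rw [Units.smul_mk0, Algebra.algebraMap_eq_smul_one, Algebra.algebraMap_eq_smul_one, smul_sub,
      smul_smul, neg_mul, hzz, smul_neg, neg_smul (star z), neg_neg]
  have hexp := congrArg Subtype.val (expUnitary_argSelfAdjoint (u := ⟨_, hW⟩) hlt)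
  replace hexp : NormedSpace.exp (Complex.I •
      (Unitary.argSelfAdjoint ⟨star z • U, hW⟩ : Matrix (Fin d) (Fin d) ℂ)) = star z • U := hexp
  obtain ⟨V, hV, hV', θ, hθ⟩ := exists_diagonal_of_isHermitian
    (A := (Unitary.argSelfAdjoint ⟨star z • U, hW⟩ : Matrix (Fin d) (Fin d) ℂ))
    (Unitary.argSelfAdjoint ⟨star z • U, hW⟩).2
  refine ⟨V, hV, hV', fun i => φ + θ i, ?_⟩
  have h1 : U = z • (star z • U) := by rw [smul_smul, mul_comm, hzz, one_smul]
  have h2 : (fun i => Complex.exp (((φ + θ i : ℝ) : ℂ) * Complex.I)) =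
      z • fun i => Complex.exp ((Complex.I • fun i => (θ i : ℂ)) i) := by
    ext i
    rw [Pi.smul_apply, smul_eq_mul, hz, ← Complex.exp_add, Pi.smul_apply, smul_eq_mul]
    congr 1
    push_cast
    ring
  rw [h1, ← hexp, hθ, ← Matrix.smul_mul, ← Matrix.mul_smul, ← diagonal_smul,
    exp_unitary_conj_diagonal hV', h2, diagonal_smul, Matrix.mul_smul, Matrix.smul_mul]

/-- Antihermitian matrices are `i` times Hermitian ones, hence diagonalizable with imaginary
eigenvalues. -/
lemma exists_diagonal_of_conjTranspose_eq_neg {X : Matrix (Fin d) (Fin d) ℂ} (hX : Xᴴ = -X) :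
    ∃ V : Matrix (Fin d) (Fin d) ℂ, Vᴴ * V = 1 ∧ V * Vᴴ = 1 ∧
      ∃ θ : Fin d → ℝ, X = V * diagonal (fun i => θ i * Complex.I) * Vᴴ := by
  have hA : (-Complex.I • X).IsHermitian := by
    rw [IsHermitian, conjTranspose_smul, hX]
    simp
  obtain ⟨V, hV, hV', θ, hθ⟩ := exists_diagonal_of_isHermitian hA
  refine ⟨V, hV, hV', θ, ?_⟩
  have h1 : X = Complex.I • (-Complex.I • X) := by simp [smul_smul]
  have h2 : (fun i => (θ i : ℂ) * Complex.I) = Complex.I • fun i => (θ i : ℂ) := by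
    ext i
    simp [mul_comm]
  rw [h1, hθ, h2, diagonal_smul, Matrix.mul_smul, Matrix.smul_mul]

lemma det_exp_of_conjTranspose_eq_neg {X : Matrix (Fin d) (Fin d) ℂ} (hX : Xᴴ = -X) :
    (NormedSpace.exp X).det = Complex.exp X.trace := by
  obtain ⟨V, hV, hV', θ, rfl⟩ := exists_diagonal_of_conjTranspose_eq_neg hX
  rw [exp_unitary_conj_diagonal hV', det_mul, mul_comm, ← det_mul, ← mul_assoc, hV, one_mul,
    det_diagonal, ← Complex.exp_sum, trace_mul_comm, ← mul_assoc, hV, one_mul, trace_diagonal]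

end Diagonalization

/-! ### Commutators contract -/

section Commutator

variable {d : ℕ}

/-- Two numbers of the unit circle whose distances to a third one, `a`, have squares with sum at
most `1 / 2` are at distance less than `1`. -/
lemma norm_sub_sq_lt_one {x y a : ℂ} (hx : ‖x‖ = 1) (hy : ‖y‖ = 1) (ha : ‖a‖ = 1)
    (h : ‖x - a‖ ^ 2 + ‖y - a‖ ^ 2 ≤ 1 / 2) : ‖x - y‖ ^ 2 < 1 := by
  -- By the parallelogram law equality forces `x + y = 2 a`, hence `x = y = a`.
  by_contra! hge
  have hpar := parallelogram_law_with_norm ℝ (x - a) (y - a)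
  rw [show x - a - (y - a) = x - y by ring] at hpar
  have hz : ‖x - a + (y - a)‖ = 0 := by
    nlinarith [norm_nonneg (x - a + (y - a))]
  have hsum : y = 2 * a - x := by linear_combination norm_eq_zero.1 hz
  have hpar2 := parallelogram_law_with_norm ℝ a (x - a)
  rw [show a + (x - a) = x by ring, show a - (x - a) = y by rw [hsum]; ring, hx, hy, ha] at hpar2
  have hxa : ‖x - a‖ = 0 := by nlinarith [norm_nonneg (x - a)]
  have hx' : x = a := sub_eq_zero.1 (norm_eq_zero.1 hxa)
  rw [hsum, hx', show a - (2 * a - a) = 0 by ring] at hge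
  norm_num at hge

/-- In an eigenbasis of `g` the commutator with `g` multiplies the entries of a matrix by
differences of eigenvalues of `g`, which are less than `1` in absolute value. -/
lemma hsNorm_commutator_lt (hd : d ≠ 0) {g : SU d} {a : ℂ} (ha : a ^ d = 1) (hg : g ∈ ballAt d a)
    {Y : Matrix (Fin d) (Fin d) ℂ} (hY : Y ≠ 0) :
    hsNorm ((g : Matrix (Fin d) (Fin d) ℂ) * Y - Y * (g : Matrix (Fin d) (Fin d) ℂ))
      < hsNorm Y := by
  obtain ⟨V, hV, hV', θ, hθ⟩ := exists_diagonal_of_mem_unitary g.mem_unitary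
  set e : Fin d → ℂ := fun i => Complex.exp (θ i * Complex.I) with he
  have hnorm : ∀ i, ‖e i‖ = 1 := fun i => Complex.norm_exp_ofReal_mul_I _
  have hball : ∑ i, ‖e i - a‖ ^ 2 ≤ 1 / 2 := by
    have h1 : hsNorm ((g : Matrix (Fin d) (Fin d) ℂ) - a • (1 : Matrix (Fin d) (Fin d) ℂ)) ^ 2
        = ∑ i, ‖e i - a‖ ^ 2 := by
      have h2 : (g : Matrix (Fin d) (Fin d) ℂ) - a • (1 : Matrix (Fin d) (Fin d) ℂ)
          = V * diagonal (fun i => e i - a) * Vᴴ := by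
        rw [← diagonal_sub, mul_sub, sub_mul, ← hθ, ← smul_one_eq_diagonal, Matrix.mul_smul,
          Matrix.smul_mul, mul_one, hV']
      rw [h2, hsNorm_mul_unitary (by rwa [conjTranspose_conjTranspose]), hsNorm_unitary_mul hV,
        hsNorm_sq]
      refine Finset.sum_congr rfl fun i _ => ?_
      rw [Finset.sum_eq_single i, diagonal_apply_eq]
      · intro j _ hj
        rw [diagonal_apply_ne' _ hj]
        simp
      · simp
    rw [← h1]
    calc _ ≤ (1 / Real.sqrt 2) ^ 2 := by gcongr; exacts [hsNorm_nonneg _, hg]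
      _ = 1 / 2 := by rw [div_pow, Real.sq_sqrt (by norm_num), one_pow]
  have hgap : ∀ i j, ‖e i - e j‖ ^ 2 < 1 := by
    intro i j
    rcases eq_or_ne i j with rfl | hij
    · simp
    refine norm_sub_sq_lt_one (hnorm i) (hnorm j) (Complex.norm_eq_one_of_pow_eq_one ha hd) ?_
    rw [← Finset.sum_pair (f := fun i => ‖e i - a‖ ^ 2) hij]
    exact (Finset.sum_le_sum_of_subset_of_nonneg (Finset.subset_univ _)
      fun _ _ _ => by positivity).trans hball
  set Z := Vᴴ * Y * V with hZdef
  have hYZ : Y = V * Z * Vᴴ := by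
    rw [hZdef, mul_assoc, mul_assoc, mul_assoc, hV', mul_one, ← mul_assoc, hV', one_mul]
  have hZ : Z ≠ 0 := by
    intro h
    rw [h, mul_zero, zero_mul] at hYZ
    exact hY hYZ
  have hcomm : (g : Matrix (Fin d) (Fin d) ℂ) * Y - Y * (g : Matrix (Fin d) (Fin d) ℂ)
      = V * (diagonal e * Z - Z * diagonal e) * Vᴴ := by
    have h1 : ∀ A B : Matrix (Fin d) (Fin d) ℂ,
        V * A * Vᴴ * (V * B * Vᴴ) = V * (A * B) * Vᴴ := fun A B => by
      rw [mul_assoc (V * A), ← mul_assoc Vᴴ, ← mul_assoc Vᴴ, hV, one_mul, mul_assoc V, mul_assoc V,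
        mul_assoc A]
    rw [hθ, hYZ, h1, h1, mul_sub, sub_mul]
  have hVs : Vᴴ * Vᴴᴴ = 1 := by rwa [conjTranspose_conjTranspose]
  rw [hcomm, hsNorm_mul_unitary hVs, hsNorm_unitary_mul hV, hYZ, hsNorm_mul_unitary hVs,
    hsNorm_unitary_mul hV]
  refine lt_of_pow_lt_pow_left₀ 2 (hsNorm_nonneg _) ?_
  rw [hsNorm_sq, hsNorm_sq]
  obtain ⟨i₀, j₀, h₀⟩ : ∃ i j, Z i j ≠ 0 := by
    by_contra! h
    exact hZ (by ext i j; exact h i j)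
  have hentry : ∀ i j, (diagonal e * Z - Z * diagonal e) i j = (e i - e j) * Z i j := by
    intro i j
    rw [Matrix.sub_apply, diagonal_mul, mul_diagonal]
    ring
  have hle : ∀ i j, ‖(diagonal e * Z - Z * diagonal e) i j‖ ^ 2 ≤ ‖Z i j‖ ^ 2 := by
    intro i j
    rw [hentry, norm_mul, mul_pow]
    exact mul_le_of_le_one_left (by positivity) (hgap i j).le
  refine Finset.sum_lt_sum (fun i _ => Finset.sum_le_sum fun j _ => hle i j)
    ⟨i₀, Finset.mem_univ _, Finset.sum_lt_sum (fun j _ => hle i₀ j) ⟨j₀, Finset.mem_univ _, ?_⟩⟩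
  rw [hentry, norm_mul, mul_pow]
  exact mul_lt_of_lt_one_left (by positivity) (hgap i₀ j₀)

end Commutator

/-! ### Irreducibility of the adjoint representation -/

section Adjoint

variable {d : ℕ}

lemma coe_Ad (U : SU d) (x : su d) : (Ad U x : Matrix (Fin d) (Fin d) ℂ) =
    (U : Matrix (Fin d) (Fin d) ℂ) * x * (U : Matrix (Fin d) (Fin d) ℂ)ᴴ := rfl

lemma Ad_mul_apply (U W : SU d) (x : su d) : Ad (U * W) x = Ad U (Ad W x) := by
  ext1
  rw [coe_Ad, coe_Ad, coe_Ad, Submonoid.coe_mul, conjTranspose_mul]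
  simp only [mul_assoc]

/-- The inner product of `𝔰𝔲(d)` as a bilinear form. -/
noncomputable def suForm (d : ℕ) : LinearMap.BilinForm ℝ (su d) :=
  LinearMap.mk₂ ℝ suInner
    (fun x y z => by simp [suInner, add_mul, mul_add])
    (fun c x y => by simp [suInner]; ring)
    (fun x y z => by simp [suInner, mul_add])
    (fun c x y => by simp [suInner]; ring)

lemma suForm_apply (x y : su d) : suForm d x y = suInner x y := rfl

lemma suInner_comm (x y : su d) : suInner x y = suInner y x := by
  rw [suInner, suInner, trace_mul_comm]

lemma suInner_self (x : su d) :
    suInner x x = 1 / 2 * hsNorm (x : Matrix (Fin d) (Fin d) ℂ) ^ 2 := by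
  rw [hsNorm_sq_eq_trace, x.2.1, suInner, mul_neg, trace_neg, Complex.neg_re]
  ring

lemma eq_zero_of_suInner_self {x : su d} (h : suInner x x = 0) : x = 0 := by
  by_contra hx
  have := hsNorm_pos (A := (x : Matrix (Fin d) (Fin d) ℂ)) (by simpa using hx)
  rw [suInner_self] at h
  nlinarith

lemma suInner_Ad (U : SU d) (x y : su d) : suInner (Ad U x) y = suInner x (Ad U⁻¹ y) := by
  rw [suInner, suInner, coe_Ad, coe_Ad, SU.coe_inv, conjTranspose_conjTranspose, mul_assoc,
    mul_assoc, trace_mul_comm]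
  simp only [mul_assoc]

/-- If only scalar matrices commute with the matrices of `Ad (U i)`, then the representation is
irreducible: the orthogonal projection onto an invariant subspace commutes with them. -/
lemma eq_bot_or_eq_top_of_Ad_invariant {ι : Type*} {U : ι → SU d}
    {X : Module.Basis (Fin (d ^ 2 - 1)) ℝ (su d)}
    (hC : Set.centralizer (Set.range fun i => AdMatrix X (U i)) =
      {L | ∃ c : ℝ, L = c • (1 : Matrix (Fin (d ^ 2 - 1)) (Fin (d ^ 2 - 1)) ℝ)})
    {V : Submodule ℝ (su d)} (hV : ∀ i, ∀ x ∈ V, Ad (U i) x ∈ V)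
    (hV' : ∀ i, ∀ x ∈ V, Ad (U i)⁻¹ x ∈ V) : V = ⊥ ∨ V = ⊤ := by
  have : FiniteDimensional ℝ (su d) := X.finiteDimensional_of_finite
  have hrefl : (suForm d).IsRefl := fun x y h => by rwa [suForm_apply, suInner_comm] at h
  have hdisj : Disjoint V ((suForm d).orthogonal V) := by
    rw [Submodule.disjoint_def]
    intro x hx hx'
    exact eq_zero_of_suInner_self (hx' x hx)
  have hcompl := (LinearMap.BilinForm.isCompl_orthogonal_iff_disjoint hrefl).2 hdisj
  set P := V.projection _ hcompl with hP
  have hcomm : ∀ i, Commute P (Ad (U i)) := by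
    intro i
    rw [LinearMap.IsIdempotentElem.commute_iff (Submodule.isIdempotentElem_projection hcompl),
      Submodule.range_projection, Submodule.ker_projection]
    refine ⟨fun x hx => hV i x hx, fun x hx v hv => ?_⟩
    change suInner v (Ad (U i) x) = 0
    rw [suInner_comm, suInner_Ad, suInner_comm]
    exact hx _ (hV' i v hv)
  have hmem : LinearMap.toMatrix X X P ∈
      Set.centralizer (Set.range fun i => AdMatrix X (U i)) := by
    rw [Set.mem_centralizer_iff]
    rintro _ ⟨i, rfl⟩
    simp only [AdMatrix]
    rw [← LinearMap.toMatrix_mul, ← LinearMap.toMatrix_mul, (hcomm i).eq]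
  rw [hC] at hmem
  obtain ⟨c, hc⟩ := hmem
  rw [← LinearMap.toMatrix_one X, ← map_smul] at hc
  replace hc : P = c • 1 := (LinearMap.toMatrix X X).injective hc
  refine or_iff_not_imp_left.2 fun hbot => ?_
  obtain ⟨v, hv, hv0⟩ := V.ne_bot_iff.1 hbot
  have hPv : P v = v := Submodule.projection_apply_of_mem_left hcompl hv
  have hc1 : c = 1 := by
    rw [hc] at hPv
    exact smul_left_injective ℝ hv0 (hPv.trans (one_smul ℝ v).symm)
  have hPtop := Submodule.range_projection hcompl
  rw [← hP, hc, hc1, one_smul] at hPtop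
  rw [← hPtop]
  exact LinearMap.range_id

/-- An antihermitian matrix differs from its traceless part by a scalar. -/
lemma exists_su_add_smul_one (hd : d ≠ 0) {M : Matrix (Fin d) (Fin d) ℂ} (hM : Mᴴ = -M) :
    ∃ (x : su d) (s : ℂ), M = x + s • (1 : Matrix (Fin d) (Fin d) ℂ) := by
  have hd' : (d : ℂ) ≠ 0 := Nat.cast_ne_zero.2 hd
  have hs : star (M.trace / d) = -(M.trace / d) := by
    rw [star_div₀, ← trace_conjTranspose, hM, trace_neg, neg_div]
    simp
  refine ⟨⟨M - (M.trace / d) • 1, ?_, ?_⟩, M.trace / d, by simp⟩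
  · rw [conjTranspose_sub, conjTranspose_smul, hM, hs, conjTranspose_one, neg_smul]
    abel
  · rw [trace_sub, trace_smul, trace_one, Fintype.card_fin, smul_eq_mul, div_mul_cancel₀ _ hd',
      sub_self]

lemma conjTranspose_sub_conjTranspose (A : Matrix (Fin d) (Fin d) ℂ) : (A - Aᴴ)ᴴ = -(A - Aᴴ) := by
  rw [conjTranspose_sub, conjTranspose_conjTranspose, neg_sub]

lemma conjTranspose_I_smul_add (A : Matrix (Fin d) (Fin d) ℂ) :
    (Complex.I • (A + Aᴴ))ᴴ = -(Complex.I • (A + Aᴴ)) := by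
  rw [conjTranspose_smul, conjTranspose_add, conjTranspose_conjTranspose, Complex.star_def,
    Complex.conj_I, neg_smul, add_comm]

/-- Every matrix is a complex combination of two antihermitian ones. -/
lemma eq_half_smul_add (A : Matrix (Fin d) (Fin d) ℂ) :
    A = (1 / 2 : ℂ) • (A - Aᴴ) + (-Complex.I / 2) • (Complex.I • (A + Aᴴ)) := by
  rw [smul_smul, show -Complex.I / 2 * Complex.I = 1 / 2 by linear_combination (-1/2) * Complex.I_sq,
    ← smul_add, sub_add_add_cancel, ← two_smul ℂ A, smul_smul]
  norm_num

/-- By Schur's lemma for the standard representation, only scalars commute with `𝔰𝔲(d)`. -/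
lemma exists_eq_smul_one_of_commute_su (hd : d ≠ 0) {A : Matrix (Fin d) (Fin d) ℂ}
    (h : ∀ x : su d, Commute A (x : Matrix (Fin d) (Fin d) ℂ)) :
    ∃ a : ℂ, A = a • (1 : Matrix (Fin d) (Fin d) ℂ) := by
  have hanti : ∀ M : Matrix (Fin d) (Fin d) ℂ, Mᴴ = -M → Commute A M := by
    intro M hM
    obtain ⟨x, s, rfl⟩ := exists_su_add_smul_one hd hM
    exact (h x).add_right ((Commute.one_right A).smul_right s)
  have hall : ∀ M : Matrix (Fin d) (Fin d) ℂ, Commute A M := by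
    intro M
    rw [eq_half_smul_add M]
    exact ((hanti _ (conjTranspose_sub_conjTranspose M)).smul_right _).add_right
      ((hanti _ (conjTranspose_I_smul_add M)).smul_right _)
  obtain ⟨a, ha⟩ := mem_range_scalar_of_commute_single (M := A)
    fun i j _ => (hall (single i j 1)).symm
  exact ⟨a, by rw [← ha, smul_one_eq_diagonal]; rfl⟩

end Adjoint

/-! ### Finite subgroups with irreducible adjoint action -/

section Finite

variable {d : ℕ}

/-- An element of `SU(d)` with trace zero is far from all scalars. -/
lemma trace_ne_zero_of_mem_ballAt (hd : d ≠ 0) {h : SU d} {b : ℂ} (hb : b ^ d = 1)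
    (hh : h ∈ ballAt d b) : (h : Matrix (Fin d) (Fin d) ℂ).trace ≠ 0 := by
  intro htr
  have hbb : b * star b = 1 := by
    rw [Complex.star_def, Complex.mul_conj, Complex.normSq_eq_norm_sq,
      Complex.norm_eq_one_of_pow_eq_one hb hd]
    simp
  have h1 : hsNorm ((h : Matrix (Fin d) (Fin d) ℂ) - b • (1 : Matrix (Fin d) (Fin d) ℂ)) ^ 2
      = 2 * d := by
    rw [hsNorm_sq_eq_trace, conjTranspose_sub, conjTranspose_smul, conjTranspose_one, mul_sub,
      sub_mul, sub_mul, h.mul_conjTranspose_self]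
    simp only [Matrix.mul_smul, Matrix.smul_mul, mul_one, one_mul, trace_sub, trace_smul, trace_one,
      trace_conjTranspose, htr, smul_smul, mul_comm (star b), hbb]
    simp
    ring
  have h2 : hsNorm ((h : Matrix (Fin d) (Fin d) ℂ) - b • (1 : Matrix (Fin d) (Fin d) ℂ)) ^ 2
      ≤ (1 / Real.sqrt 2) ^ 2 := by
    gcongr
    exacts [hsNorm_nonneg _, hh]
  rw [h1, div_pow, Real.sq_sqrt (by norm_num)] at h2
  have : (1 : ℝ) ≤ d := by exact_mod_cast Nat.one_le_iff_ne_zero.2 hd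
  linarith

/-- The balls `B_b` are invariant under conjugation. -/
lemma conj_mem_ballAt {h : SU d} {b : ℂ} (hh : h ∈ ballAt d b) (k : SU d) :
    k * h * k⁻¹ ∈ ballAt d b := by
  have h1 : ((k * h * k⁻¹ : SU d) : Matrix (Fin d) (Fin d) ℂ) - b • 1 =
      (k : Matrix (Fin d) (Fin d) ℂ) * ((h : Matrix (Fin d) (Fin d) ℂ) - b • 1) *
        (k : Matrix (Fin d) (Fin d) ℂ)ᴴ := by
    rw [Submonoid.coe_mul, Submonoid.coe_mul, SU.coe_inv, mul_sub, sub_mul, Matrix.mul_smul,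
      mul_one, Matrix.smul_mul, k.mul_conjTranspose_self]
  change hsNorm _ ≤ _
  rw [h1, hsNorm_mul_unitary (by rw [conjTranspose_conjTranspose, k.conjTranspose_mul_self]),
    hsNorm_unitary_mul k.conjTranspose_mul_self]
  exact hh

lemma finite_setOf_pow_eq_one (hd : d ≠ 0) : {a : ℂ | a ^ d = 1}.Finite := by
  refine (Polynomial.nthRoots d (1 : ℂ)).toFinset.finite_toSet.subset fun a ha => ?_
  simpa [Polynomial.mem_nthRoots (Nat.pos_of_ne_zero hd)] using ha

lemma dim_ne_zero_of_not_mem_centreSU {g : SU d} (hg : g ∉ centreSU d) : d ≠ 0 := by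
  rintro rfl
  exact hg ⟨1, pow_zero 1, Subsingleton.elim _ _⟩

/-- Let `h` be a noncentral element of `H` whose distance to the scalars is minimal, say equal to
its distance to `b`. If `g ∈ H` lies in a ball `B_a`, then the commutator of `g` and `h` is closer
to `1`, hence central; and it is not a nontrivial scalar because `h` has nonzero trace. -/
lemma commute_of_minimal (H : Subgroup (SU d)) {h : SU d} (hH : h ∈ H) (hc : h ∉ centreSU d)
    {b : ℂ} (hb : b ^ d = 1) (hh : h ∈ ballAt d b)
    (hmin : ∀ g ∈ H, g ∉ centreSU d → ∀ a : ℂ, a ^ d = 1 →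
      hsNorm ((h : Matrix (Fin d) (Fin d) ℂ) - b • (1 : Matrix (Fin d) (Fin d) ℂ)) ≤
        hsNorm ((g : Matrix (Fin d) (Fin d) ℂ) - a • (1 : Matrix (Fin d) (Fin d) ℂ)))
    {g : SU d} (hgH : g ∈ H) {a : ℂ} (ha : a ^ d = 1) (hg : g ∈ ballAt d a) : Commute g h := by
  have hd := dim_ne_zero_of_not_mem_centreSU hc
  have hY : (h : Matrix (Fin d) (Fin d) ℂ) - b • (1 : Matrix (Fin d) (Fin d) ℂ) ≠ 0 :=
    fun h0 => hc ⟨b, hb, sub_eq_zero.1 h0⟩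
  have hlt := hsNorm_commutator_lt hd ha hg hY
  have hcommH : g * h * (h * g)⁻¹ ∈ H :=
    H.mul_mem (H.mul_mem hgH hH) (H.inv_mem (H.mul_mem hH hgH))
  have heq : hsNorm (((g * h * (h * g)⁻¹ : SU d) : Matrix (Fin d) (Fin d) ℂ) -
      (1 : ℂ) • (1 : Matrix (Fin d) (Fin d) ℂ)) =
      hsNorm ((g : Matrix (Fin d) (Fin d) ℂ) * ((h : Matrix (Fin d) (Fin d) ℂ) - b • 1) -
        ((h : Matrix (Fin d) (Fin d) ℂ) - b • 1) * (g : Matrix (Fin d) (Fin d) ℂ)) := by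
    rw [← hsNorm_mul_unitary (h * g).mul_conjTranspose_self, sub_mul, one_smul, one_mul,
      ← Submonoid.coe_mul, inv_mul_cancel_right, mul_sub, sub_mul, Submonoid.coe_mul,
      Submonoid.coe_mul, Matrix.mul_smul, Matrix.smul_mul, mul_one, one_mul, sub_sub_sub_cancel_right]
  have hcentral : g * h * (h * g)⁻¹ ∈ centreSU d := by
    by_contra hnc
    have := hmin _ hcommH hnc 1 (one_pow d)
    rw [heq] at this
    exact this.not_gt hlt
  obtain ⟨c, -, hcc⟩ := hcentral
  have hgh : ((g * h : SU d) : Matrix (Fin d) (Fin d) ℂ) = c • ((h * g : SU d) : Matrix _ _ ℂ) := by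
    have : g * h = g * h * (h * g)⁻¹ * (h * g) := by group
    rw [this, Submonoid.coe_mul, hcc, Matrix.smul_mul, one_mul]
  have htr : (h : Matrix (Fin d) (Fin d) ℂ).trace = c * (h : Matrix (Fin d) (Fin d) ℂ).trace := by
    have h1 : ((g * h * g⁻¹ : SU d) : Matrix (Fin d) (Fin d) ℂ) =
        c • (h : Matrix (Fin d) (Fin d) ℂ) := by
      rw [Submonoid.coe_mul, hgh, Matrix.smul_mul, ← Submonoid.coe_mul, mul_inv_cancel_right]
    rw [← smul_eq_mul, ← trace_smul, ← h1, Submonoid.coe_mul, Submonoid.coe_mul, trace_mul_comm,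
      ← mul_assoc, SU.coe_inv, g.conjTranspose_mul_self, one_mul]
  have hc1 : c = 1 :=
    (mul_eq_right₀ (trace_ne_zero_of_mem_ballAt hd hb hh)).1 htr.symm
  rw [hc1, one_smul] at hgh
  exact Subtype.ext hgh

/-- The antihermitian traceless matrices all of whose `H`-conjugates commute with `h`. -/
def conjCentralizer (H : Subgroup (SU d)) (h : SU d) : Submodule ℝ (su d) where
  carrier := {x | ∀ k ∈ H, Commute (h : Matrix (Fin d) (Fin d) ℂ) (Ad k x : Matrix _ _ ℂ)}
  add_mem' := fun {x y} hx hy k hk => by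
    rw [map_add]
    exact (hx k hk).add_right (hy k hk)
  zero_mem' := fun k _ => by
    rw [map_zero]
    exact Commute.zero_right _
  smul_mem' := fun c x hx k hk => by
    rw [map_smul]
    exact (hx k hk).smul_right c

lemma Ad_mem_conjCentralizer {H : Subgroup (SU d)} {h g : SU d} (hg : g ∈ H) {x : su d}
    (hx : x ∈ conjCentralizer H h) : Ad g x ∈ conjCentralizer H h := fun k hk => by
  rw [← Ad_mul_apply]
  exact hx _ (H.mul_mem hk hg)

/-- A finite subgroup of `SU(d)` with irreducible adjoint action meets the balls `B_a` only in
central elements. Otherwise a noncentral element `h` closest to the scalars commutes with its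
conjugates, and the matrices commuting with these conjugates form an invariant subspace, which
is neither zero nor everything. -/
theorem mem_centreSU_of_finite {H : Subgroup (SU d)} (hfin : (H : Set (SU d)).Finite)
    (hirr : ∀ V : Submodule ℝ (su d), (∀ g ∈ H, ∀ x ∈ V, Ad g x ∈ V) → V = ⊥ ∨ V = ⊤)
    {g : SU d} (hgH : g ∈ H) (hg : g ∈ ballUnion d) : g ∈ centreSU d := by
  by_contra hgc
  have hd := dim_ne_zero_of_not_mem_centreSU hgc
  obtain ⟨a, ha, hga⟩ := hg
  obtain ⟨⟨h, b⟩, ⟨⟨hH, hb⟩, hc⟩, hmin⟩ := Set.exists_min_image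
    (((H : Set (SU d)) ×ˢ {a : ℂ | a ^ d = 1}) ∩ {p | p.1 ∉ centreSU d})
    (fun p => hsNorm ((p.1 : Matrix (Fin d) (Fin d) ℂ) - p.2 • (1 : Matrix (Fin d) (Fin d) ℂ)))
    ((hfin.prod (finite_setOf_pow_eq_one hd)).inter_of_left _) ⟨(g, a), ⟨hgH, ha⟩, hgc⟩
  have hh : h ∈ ballAt d b := (hmin (g, a) ⟨⟨hgH, ha⟩, hgc⟩).trans hga
  have hcomm : ∀ k ∈ H, Commute (k * h * k⁻¹) h := fun k hk =>
    commute_of_minimal H hH hc hb hh (fun g hg hgc a ha => hmin (g, a) ⟨⟨hg, ha⟩, hgc⟩)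
      (H.mul_mem (H.mul_mem hk hH) (H.inv_mem hk)) hb (conj_mem_ballAt hh k)
  set M := (h : Matrix (Fin d) (Fin d) ℂ) with hM
  have hconj : ∀ k ∈ H, Commute M ((k : Matrix (Fin d) (Fin d) ℂ) * M *
      (k : Matrix (Fin d) (Fin d) ℂ)ᴴ) := fun k hk =>
    congrArg Subtype.val (hcomm k hk).symm.eq
  have hconj' : ∀ k ∈ H, Commute M ((k : Matrix (Fin d) (Fin d) ℂ) * Mᴴ *
      (k : Matrix (Fin d) (Fin d) ℂ)ᴴ) := fun k hk => by
    have h1 := (hcomm k hk).symm.inv_right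
    rw [_root_.mul_inv_rev, _root_.mul_inv_rev, inv_inv, ← mul_assoc] at h1
    exact congrArg Subtype.val h1.eq
  rcases hirr (conjCentralizer H h) (fun g hg x hx => Ad_mem_conjCentralizer hg hx) with h0 | h1
  · -- The traceless antihermitian parts of `h` and of `i h` would vanish.
    have hscalar : ∀ p q : ℂ, (p • M + q • Mᴴ)ᴴ = -(p • M + q • Mᴴ) →
        ∃ s : ℂ, p • M + q • Mᴴ = s • 1 := by
      intro p q hpq
      obtain ⟨x, s, hx⟩ := exists_su_add_smul_one hd hpq
      have hxV : x ∈ conjCentralizer H h := by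
        intro k hk
        rw [coe_Ad, ← sub_eq_iff_eq_add.2 hx, mul_sub, sub_mul, mul_add, add_mul]
        simp only [Matrix.mul_smul, Matrix.smul_mul, mul_one, k.mul_conjTranspose_self]
        exact (((hconj k hk).smul_right p).add_right ((hconj' k hk).smul_right q)).sub_right
          ((Commute.one_right _).smul_right s)
      rw [h0, Submodule.mem_bot] at hxV
      exact ⟨s, by rw [hx, hxV]; simp⟩
    obtain ⟨s, hs⟩ := hscalar 1 (-1) (by simp)
    obtain ⟨t, ht⟩ := hscalar Complex.I Complex.I (by
      simpa only [smul_add] using conjTranspose_I_smul_add M)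
    refine hc (SU.mem_centreSU_of_eq_smul (a := 1 / 2 * s + -Complex.I / 2 * t) ?_)
    change M = _
    rw [one_smul, neg_one_smul, ← sub_eq_add_neg] at hs
    rw [← smul_add] at ht
    rw [eq_half_smul_add M, hs, ht, smul_smul, smul_smul, ← add_smul]
  · obtain ⟨s, hs⟩ := exists_eq_smul_one_of_commute_su hd (A := M) fun x => by
      have hx : x ∈ conjCentralizer H h := h1 ▸ Submodule.mem_top
      have h2 := hx 1 H.one_mem
      rw [coe_Ad, OneMemClass.coe_one, conjTranspose_one, one_mul, mul_one] at h2
      exact h2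
    exact hc (SU.mem_centreSU_of_eq_smul hs)

end Finite

/-! ### One-parameter subgroups of closed subgroups -/

section Lie

variable {d : ℕ}

open scoped Matrix.Norms.L2Operator
open Filter Topology

lemma norm_le_one_of_mem_unitary {A : Matrix (Fin d) (Fin d) ℂ}
    (hA : A ∈ unitary (Matrix (Fin d) (Fin d) ℂ)) : ‖A‖ ≤ 1 := by
  rcases subsingleton_or_nontrivial (Matrix (Fin d) (Fin d) ℂ) with h | h
  · rw [Subsingleton.elim A 0, norm_zero]
    exact zero_le_one
  · exact (CStarRing.norm_of_mem_unitary hA).le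

lemma norm_pow_sub_pow_le {A B : Matrix (Fin d) (Fin d) ℂ}
    (hA : A ∈ unitary (Matrix (Fin d) (Fin d) ℂ)) (hB : B ∈ unitary (Matrix (Fin d) (Fin d) ℂ))
    (n : ℕ) : ‖A ^ n - B ^ n‖ ≤ n * ‖A - B‖ := by
  induction n with
  | zero => simp
  | succ n ih =>
    have h1 : A ^ (n + 1) - B ^ (n + 1) = A ^ n * (A - B) + (A ^ n - B ^ n) * B := by
      rw [pow_succ, pow_succ]
      noncomm_ring
    rw [h1]
    calc _ ≤ ‖A ^ n‖ * ‖A - B‖ + ‖A ^ n - B ^ n‖ * ‖B‖ :=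
          (norm_add_le _ _).trans (add_le_add (norm_mul_le _ _) (norm_mul_le _ _))
      _ ≤ 1 * ‖A - B‖ + n * ‖A - B‖ * 1 := by
          gcongr
          · exact norm_le_one_of_mem_unitary (pow_mem hA n)
          · exact norm_le_one_of_mem_unitary hB
      _ = _ := by push_cast; ring

lemma conjTranspose_real_smul_eq_neg {x : Matrix (Fin d) (Fin d) ℂ} (hx : xᴴ = -x) (t : ℝ) :
    (t • x)ᴴ = -(t • x) := by
  rw [conjTranspose_smul, hx, star_trivial, smul_neg]

lemma exp_mem_unitary {x : Matrix (Fin d) (Fin d) ℂ} (hx : xᴴ = -x) :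
    NormedSpace.exp x ∈ unitary (Matrix (Fin d) (Fin d) ℂ) := by
  have h : ∀ y : Matrix (Fin d) (Fin d) ℂ, NormedSpace.exp (-y) * NormedSpace.exp y = 1 :=
    fun y => by
      rw [← exp_add_of_commute _ _ (Commute.neg_left (Commute.refl y)), neg_add_cancel,
        NormedSpace.exp_zero]
  have hs : star (NormedSpace.exp x) = NormedSpace.exp (-x) := by
    rw [← hx]
    exact (exp_conjTranspose x).symm
  rw [Unitary.mem_iff, hs]
  exact ⟨h x, by simpa using h (-x)⟩

lemma tendsto_slope_exp (x : Matrix (Fin d) (Fin d) ℂ) :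
    Tendsto (fun u : ℝ => u⁻¹ • (NormedSpace.exp (u • x) - 1)) (𝓝[≠] 0) (𝓝 x) := by
  have h := (hasDerivAt_exp_smul_const (𝕂 := ℝ) x 0).tendsto_slope_zero
  simpa using h

/-- If unitary matrices `g i` tend to `1` in the direction `x` at speed `s i`, then suitable powers
of them tend to `exp (t x)`: powers of unitary matrices are Lipschitz in the base. -/
lemma tendsto_pow_exp {ι : Type*} {l : Filter ι} {g : ι → Matrix (Fin d) (Fin d) ℂ}
    (hg : ∀ i, g i ∈ unitary (Matrix (Fin d) (Fin d) ℂ)) {s : ι → ℝ}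
    (hs : Tendsto s l (𝓝[>] 0)) {x : Matrix (Fin d) (Fin d) ℂ} (hx : xᴴ = -x)
    (hgx : Tendsto (fun i => (s i)⁻¹ • (g i - 1)) l (𝓝 x)) {t : ℝ} (ht : 0 ≤ t) :
    Tendsto (fun i => g i ^ ⌊t * (s i)⁻¹⌋₊) l (𝓝 (NormedSpace.exp (t • x))) := by
  have hspos : ∀ᶠ i in l, 0 < s i := hs.eventually self_mem_nhdsWithin
  have hn : Tendsto (fun i => (⌊t * (s i)⁻¹⌋₊ : ℝ) * s i) l (𝓝 t) := by
    have := (tendsto_nat_floor_mul_div_atTop ht).comp (tendsto_inv_nhdsGT_zero.comp hs)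
    simpa [Function.comp_def, div_eq_mul_inv] using this
  have hexp : Tendsto (fun i => NormedSpace.exp (s i • x) ^ ⌊t * (s i)⁻¹⌋₊) l
      (𝓝 (NormedSpace.exp (t • x))) := by
    have hcont : Continuous fun u : ℝ => NormedSpace.exp (u • x) :=
      continuous_iff_continuousAt.2 fun u => (hasDerivAt_exp_smul_const (𝕂 := ℝ) x u).continuousAt
    refine ((hcont.tendsto t).comp hn).congr fun i => ?_
    rw [Function.comp_apply, ← Matrix.exp_nsmul, mul_smul, Nat.cast_smul_eq_nsmul]
  have hslope : Tendsto (fun i => (s i)⁻¹ • (NormedSpace.exp (s i • x) - 1)) l (𝓝 x) :=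
    (tendsto_slope_exp x).comp (hs.mono_right (nhdsWithin_mono _ fun u hu => ne_of_gt hu))
  have hbound : Tendsto (fun i => (⌊t * (s i)⁻¹⌋₊ : ℝ) * s i *
      ‖(s i)⁻¹ • (g i - 1) - (s i)⁻¹ • (NormedSpace.exp (s i • x) - 1)‖) l (𝓝 0) := by
    simpa using hn.mul (hgx.sub hslope).norm
  have hdiff : Tendsto (fun i => g i ^ ⌊t * (s i)⁻¹⌋₊ -
      NormedSpace.exp (s i • x) ^ ⌊t * (s i)⁻¹⌋₊) l (𝓝 0) := by
    refine squeeze_zero_norm' ?_ hbound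
    filter_upwards [hspos] with i hi
    refine (norm_pow_sub_pow_le (hg i)
      (exp_mem_unitary (conjTranspose_real_smul_eq_neg hx (s i))) _).trans_eq ?_
    rw [← smul_sub, sub_sub_sub_cancel_right, norm_smul, norm_inv, Real.norm_of_nonneg hi.le,
      mul_assoc, mul_inv_cancel_left₀ hi.ne']
  simpa using hdiff.add hexp

/-- `exp (t x) ∈ H` for all real `t`. -/
def IsOneParam (H : Subgroup (SU d)) (x : Matrix (Fin d) (Fin d) ℂ) : Prop :=
  ∀ t : ℝ, ∃ g ∈ H, (g : Matrix (Fin d) (Fin d) ℂ) = NormedSpace.exp (t • x)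

/-- The limit direction of elements of a closed subgroup `H` tending to `1` generates a
one-parameter subgroup of `H`. -/
lemma isOneParam_of_tendsto {H : Subgroup (SU d)} (hH : IsClosed (H : Set (SU d)))
    {ι : Type*} {l : Filter ι} [l.NeBot] {g : ι → SU d} (hg : ∀ i, g i ∈ H) {s : ι → ℝ}
    (hs : Tendsto s l (𝓝[>] 0)) {x : Matrix (Fin d) (Fin d) ℂ} (hx : xᴴ = -x)
    (hgx : Tendsto (fun i => (s i)⁻¹ • ((g i : Matrix (Fin d) (Fin d) ℂ) - 1)) l (𝓝 x)) :
    IsOneParam H x := by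
  have hclosed : IsClosed ((fun g : SU d => (g : Matrix (Fin d) (Fin d) ℂ)) '' H) :=
    (hH.isCompact.image continuous_subtype_val).isClosed
  have hpos : ∀ t : ℝ, 0 ≤ t →
      ∃ g ∈ H, (g : Matrix (Fin d) (Fin d) ℂ) = NormedSpace.exp (t • x) := fun t ht =>
    hclosed.mem_of_tendsto (tendsto_pow_exp (fun i => (g i).mem_unitary) hs hx hgx ht)
      (Eventually.of_forall fun i => ⟨g i ^ _, H.pow_mem (hg i) _, rfl⟩)
  intro t
  rcases le_total 0 t with ht | ht
  · exact hpos t ht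
  · obtain ⟨g, hgH, hg⟩ := hpos (-t) (neg_nonneg.2 ht)
    refine ⟨g⁻¹, H.inv_mem hgH, ?_⟩
    rw [SU.coe_inv, hg, ← exp_conjTranspose, conjTranspose_real_smul_eq_neg hx, neg_smul, neg_neg]

/-- The Lie algebra of a closed subgroup of `SU(d)`. It is closed under addition because
`exp (u x) exp (u y)` tends to `1` in the direction `x + y` as `u → 0`. -/
noncomputable def lieSubspace (H : Subgroup (SU d)) (hH : IsClosed (H : Set (SU d))) :
    Submodule ℝ (su d) where
  carrier := {x | IsOneParam H (x : Matrix (Fin d) (Fin d) ℂ)}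
  zero_mem' := fun t => ⟨1, H.one_mem, by simp⟩
  smul_mem' := fun c x hx t => by
    obtain ⟨g, hgH, hg⟩ := hx (t * c)
    exact ⟨g, hgH, by rw [hg, mul_smul]; rfl⟩
  add_mem' := fun {x y} hx hy => by
    choose g hgH hg using hx
    choose k hkH hk using hy
    refine isOneParam_of_tendsto hH (l := 𝓝[>] (0 : ℝ)) (s := id)
      (fun u => H.mul_mem (hgH u) (hkH u)) tendsto_id (x + y).2.1 ?_
    have h := ((hasDerivAt_exp_smul_const (𝕂 := ℝ) (x : Matrix (Fin d) (Fin d) ℂ) 0).mul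
      (hasDerivAt_exp_smul_const (𝕂 := ℝ) (y : Matrix (Fin d) (Fin d) ℂ) 0)).tendsto_slope_zero
    have h' := h.mono_left (nhdsWithin_mono (0 : ℝ) (s := Set.Ioi 0) fun u hu => ne_of_gt hu)
    simpa [hg, hk] using h'

lemma Ad_mem_lieSubspace {H : Subgroup (SU d)} (hH : IsClosed (H : Set (SU d))) {g : SU d}
    (hg : g ∈ H) {x : su d} (hx : x ∈ lieSubspace H hH) : Ad g x ∈ lieSubspace H hH := fun t => by
  obtain ⟨k, hkH, hk⟩ := hx t
  refine ⟨g * k * g⁻¹, H.mul_mem (H.mul_mem hg hkH) (H.inv_mem hg), ?_⟩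
  have hi : (g : Matrix (Fin d) (Fin d) ℂ)⁻¹ = (g : Matrix (Fin d) (Fin d) ℂ)ᴴ :=
    inv_eq_right_inv g.mul_conjTranspose_self
  have hu : IsUnit (g : Matrix (Fin d) (Fin d) ℂ) :=
    ⟨⟨_, _, g.mul_conjTranspose_self, g.conjTranspose_mul_self⟩, rfl⟩
  rw [Submonoid.coe_mul, Submonoid.coe_mul, SU.coe_inv, hk, coe_Ad, ← hi, ← exp_conj _ _ hu,
    Matrix.mul_smul, Matrix.smul_mul]

/-- The exponential map of `SU(d)` is surjective: the eigenvalue angles of `U` have sum in `2π ℤ`,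
and one of them can be shifted to make the sum zero. -/
lemma exists_exp_eq (hd : d ≠ 0) (U : SU d) :
    ∃ x : su d, NormedSpace.exp (x : Matrix (Fin d) (Fin d) ℂ) = U := by
  obtain ⟨V, hV, hV', θ, hθ⟩ := exists_diagonal_of_mem_unitary U.mem_unitary
  have hdet := U.det_eq_one
  rw [hθ, det_mul, mul_comm, ← det_mul, ← mul_assoc, hV, one_mul, det_diagonal, ← Complex.exp_sum,
    Complex.exp_eq_one_iff] at hdet
  obtain ⟨m, hm⟩ := hdet
  let i₀ : Fin d := ⟨0, Nat.pos_of_ne_zero hd⟩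
  set v : Fin d → ℂ := fun i =>
    θ i * Complex.I - if i = i₀ then m * (2 * Real.pi * Complex.I) else 0 with hv
  have hstar : star v = -v := by
    ext i
    rw [Pi.star_apply, Pi.neg_apply, hv]
    dsimp only
    split_ifs <;> simp
    ring
  refine ⟨⟨V * diagonal v * Vᴴ, ?_, ?_⟩, ?_⟩
  · rw [conjTranspose_mul, conjTranspose_mul, conjTranspose_conjTranspose, diagonal_conjTranspose,
      hstar, ← mul_assoc, ← neg_mul, ← mul_neg, diagonal_neg]
    rfl
  · rw [trace_mul_comm, ← mul_assoc, hV, one_mul, trace_diagonal, hv, Finset.sum_sub_distrib, hm,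
      Finset.sum_ite_eq' Finset.univ i₀, if_pos (Finset.mem_univ _), sub_self]
  · change NormedSpace.exp (V * diagonal v * Vᴴ) = _
    rw [exp_unitary_conj_diagonal hV', hθ]
    congr 3
    ext i
    rw [hv]
    dsimp only
    split_ifs
    · rw [Complex.exp_sub, Complex.exp_int_mul_two_pi_mul_I, div_one]
    · rw [sub_zero]

lemma eq_top_of_lieSubspace_eq_top (hd : d ≠ 0) {H : Subgroup (SU d)}
    {hH : IsClosed (H : Set (SU d))} (h : lieSubspace H hH = ⊤) : H = ⊤ := by
  rw [eq_top_iff]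
  intro U _
  obtain ⟨x, hx⟩ := exists_exp_eq hd U
  have hxL : x ∈ lieSubspace H hH := h ▸ Submodule.mem_top
  obtain ⟨g, hgH, hg⟩ := hxL 1
  rw [one_smul, hx] at hg
  rwa [← Subtype.ext hg]

lemma trace_eq_zero_of_isOneParam {H : Subgroup (SU d)} {x : Matrix (Fin d) (Fin d) ℂ}
    (hx : xᴴ = -x) (h : IsOneParam H x) : x.trace = 0 := by
  have h1 : ∀ t : ℝ, NormedSpace.exp (t • x.trace) = 1 := by
    intro t
    obtain ⟨g, -, hg⟩ := h t
    rw [← trace_smul, ← Complex.exp_eq_exp_ℂ,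
      ← det_exp_of_conjTranspose_eq_neg (conjTranspose_real_smul_eq_neg hx t), ← hg, g.det_eq_one]
  have h2 := hasDerivAt_exp_smul_const (𝕂 := ℝ) x.trace 0
  simp only [h1] at h2
  simpa using h2.unique (hasDerivAt_const (0 : ℝ) (1 : ℂ))

/-- An infinite closed subgroup of `SU(d)` is not discrete, so that its nontrivial elements
accumulate at `1`; any limit of their directions belongs to its Lie algebra. -/
lemma lieSubspace_ne_bot {H : Subgroup (SU d)} (hH : IsClosed (H : Set (SU d)))
    (hinf : (H : Set (SU d)).Infinite) : lieSubspace H hH ≠ ⊥ := by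
  have hcpt : CompactSpace H := isCompact_iff_compactSpace.1 hH.isCompact
  have hne : (𝓝[≠] (1 : H)).NeBot := by
    rw [neBot_iff, Ne, ← isOpen_singleton_iff_punctured_nhds]
    intro hopen
    have := discreteTopology_of_isOpen_singleton_one hopen
    have : Finite H := finite_of_compact_of_discrete
    exact hinf (Set.toFinite _)
  set l : Ultrafilter H := Ultrafilter.of (𝓝[≠] (1 : H)) with hl
  have hle : (l : Filter H) ≤ 𝓝[≠] 1 := Ultrafilter.of_le _
  set c : H → Matrix (Fin d) (Fin d) ℂ := fun g => ((g : SU d) : Matrix (Fin d) (Fin d) ℂ) with hc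
  have hcont : Continuous c := continuous_subtype_val.comp continuous_subtype_val
  have hc1 : Tendsto c l (𝓝 1) := (hcont.tendsto 1).mono_left (hle.trans nhdsWithin_le_nhds)
  have hcne : ∀ᶠ g in (l : Filter H), 0 < ‖c g - 1‖ := by
    filter_upwards [hle self_mem_nhdsWithin] with g hg
    rw [norm_pos_iff, sub_ne_zero]
    exact fun h => hg (Subtype.ext (Subtype.ext h))
  have hs : Tendsto (fun g => ‖c g - 1‖) l (𝓝[>] 0) := by
    refine tendsto_nhdsWithin_iff.2 ⟨?_, hcne⟩
    simpa using (hc1.sub_const 1).norm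
  set f : H → Matrix (Fin d) (Fin d) ℂ := fun g => ‖c g - 1‖⁻¹ • (c g - 1) with hf
  have : ProperSpace (Matrix (Fin d) (Fin d) ℂ) := FiniteDimensional.proper ℂ _
  obtain ⟨x, hxs, hx⟩ := (isCompact_sphere (0 : Matrix (Fin d) (Fin d) ℂ) 1).ultrafilter_le_nhds
    (l.map f) (by
      rw [le_principal_iff]
      change ∀ᶠ g in (l : Filter H), f g ∈ _
      filter_upwards [hcne] with g hg
      rw [mem_sphere_zero_iff_norm, hf, norm_smul, norm_inv, norm_norm, inv_mul_cancel₀ hg.ne'])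
  have hfx : Tendsto f l (𝓝 x) := hx
  have hanti : xᴴ = -x := by
    have h1 : Tendsto (fun g => (f g)ᴴ) l (𝓝 xᴴ) :=
      (continuous_id.matrix_conjTranspose.tendsto x).comp hfx
    have h2 : Tendsto (fun g => -((c g)ᴴ * f g)) l (𝓝 (-(1ᴴ * x))) :=
      (((continuous_id.matrix_conjTranspose.tendsto _).comp hc1).mul hfx).neg
    rw [conjTranspose_one, one_mul] at h2
    refine tendsto_nhds_unique h1 (h2.congr fun g => ?_)
    rw [hf]
    dsimp only
    rw [conjTranspose_smul, star_trivial, Matrix.mul_smul, mul_sub,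
      (g : SU d).conjTranspose_mul_self, mul_one, conjTranspose_sub, conjTranspose_one, ← smul_neg,
      neg_sub]
  have hone : IsOneParam H x := isOneParam_of_tendsto hH (fun g : H => g.2) hs hanti hfx
  refine (Submodule.ne_bot_iff _).2 ⟨⟨x, hanti, trace_eq_zero_of_isOneParam hanti hone⟩, hone, ?_⟩
  intro h0
  rw [Subtype.ext_iff] at h0
  change x = 0 at h0
  rw [h0] at hxs
  simp at hxs

end Lie

/-! ### Recurrence in compact groups -/

section Recurrence

open Filter Topology

/-- In a compact group the powers of `x` accumulate at `x⁻¹`, so a closed subsemigroup is closed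
under inversion. -/
lemma inv_mem_of_isClosed_subsemigroup {G : Type*} [Group G] [TopologicalSpace G]
    [IsTopologicalGroup G] [CompactSpace G] {S : Subsemigroup G} (hS : IsClosed (S : Set G))
    {x : G} (hx : x ∈ S) : x⁻¹ ∈ S := by
  have h := mapClusterPt_self_zpow_atTop_pow x (-1)
  rw [_root_.zpow_neg_one] at h
  have hpow : ∀ n : ℕ, x ^ (n + 1) ∈ S := by
    intro n
    induction n with
    | zero => simpa using hx
    | succ n ih => exact pow_succ x (n + 1) ▸ S.mul_mem ih hx
  by_contra hn
  obtain ⟨n, hn1, hnS⟩ := frequently_atTop.1 (h.frequently (hS.isOpen_compl.mem_nhds hn)) 1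
  obtain ⟨m, rfl⟩ := Nat.exists_eq_add_of_le' hn1
  exact hnS (hpow m)

/-- The closure of a nonempty subsemigroup of a compact group, as a subgroup. -/
def closureSubgroup {G : Type*} [Group G] [TopologicalSpace G]
    [IsTopologicalGroup G] [CompactSpace G] (S : Subsemigroup G) (hS : (S : Set G).Nonempty) :
    Subgroup G where
  carrier := closure S
  mul_mem' := fun {_ _} hx hy => S.topologicalClosure.mul_mem hx hy
  inv_mem' := fun {_} hx =>
    inv_mem_of_isClosed_subsemigroup (S := S.topologicalClosure) isClosed_closure hx
  one_mem' := by
    obtain ⟨x, hx⟩ := hS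
    have hx' : x ∈ S.topologicalClosure := subset_closure hx
    have := S.topologicalClosure.mul_mem hx'
      (inv_mem_of_isClosed_subsemigroup isClosed_closure hx')
    rwa [mul_inv_cancel] at this

/-- In a compact group, the time that the powers of an element take to return to a given
neighbourhood of `1` is bounded. -/
lemma exists_bound_pow_mem {G : Type*} [Group G] [TopologicalSpace G]
    [IsTopologicalGroup G] [CompactSpace G] {W : Set G} (hW : IsOpen W) (h1 : (1 : G) ∈ W) :
    ∃ N : ℕ, ∀ x : G, ∃ n, 1 ≤ n ∧ n ≤ N ∧ x ^ n ∈ W := by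
  obtain ⟨t, ht⟩ := isCompact_univ.elim_finite_subcover
    (fun n : ℕ => {x : G | x ^ (n + 1) ∈ W}) (fun n => hW.preimage (continuous_pow (n + 1)))
    (fun x _ => by
      have h := (mapClusterPt_one_atTop_pow x).frequently (hW.mem_nhds h1)
      obtain ⟨n, hn, hnW⟩ := frequently_atTop.1 h 1
      obtain ⟨m, rfl⟩ := Nat.exists_eq_add_of_le' hn
      exact Set.mem_iUnion.2 ⟨m, hnW⟩)
  refine ⟨t.sup id + 1, fun x => ?_⟩
  obtain ⟨n, hn, hx⟩ := Set.mem_iUnion₂.1 (ht (Set.mem_univ x))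
  exact ⟨n + 1, by omega, Nat.succ_le_succ (Finset.le_sup (f := id) hn), hx⟩

variable {d : ℕ}

/-- The maximum in the definition of `N_{SU(d)}` exists: the return times are bounded. -/
lemma exists_bound_pow_mem_ballUnion (d : ℕ) :
    ∃ N : ℕ, ∀ U : SU d, ∃ n, 1 ≤ n ∧ n ≤ N ∧ U ^ n ∈ ballUnion d := by
  have hcont : Continuous fun U : SU d =>
      hsNorm ((U : Matrix (Fin d) (Fin d) ℂ) - (1 : ℂ) • (1 : Matrix (Fin d) (Fin d) ℂ)) :=
    continuous_hsNorm.comp (continuous_subtype_val.sub continuous_const)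
  obtain ⟨N, hN⟩ := exists_bound_pow_mem (isOpen_Iio (a := 1 / Real.sqrt 2) |>.preimage hcont) (by
    have h0 : hsNorm (0 : Matrix (Fin d) (Fin d) ℂ) = 0 := by simp [hsNorm]
    simp [h0])
  refine ⟨N, fun U => ?_⟩
  obtain ⟨n, h1, h2, h3⟩ := hN U
  refine ⟨n, h1, h2, 1, one_pow d, ?_⟩
  change hsNorm _ < _ at h3
  exact h3.le

lemma returnTime_spec (U : SU d) : 1 ≤ returnTime U ∧ U ^ returnTime U ∈ ballUnion d := by
  obtain ⟨N, hN⟩ := exists_bound_pow_mem_ballUnion d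
  obtain ⟨n, h1, -, h3⟩ := hN U
  exact Nat.sInf_mem (s := {n : ℕ | 1 ≤ n ∧ U ^ n ∈ ballUnion d}) ⟨n, h1, h3⟩

lemma returnTime_le_maxReturnTime (U : SU d) : returnTime U ≤ maxReturnTime d := by
  obtain ⟨N, hN⟩ := exists_bound_pow_mem_ballUnion d
  refine le_csSup ⟨N, ?_⟩ (Set.mem_range_self U)
  rintro _ ⟨W, rfl⟩
  obtain ⟨n, h1, h2, h3⟩ := hN W
  exact (Nat.sInf_le ⟨h1, h3⟩ : returnTime W ≤ n).trans h2

/-- If the spectrum of `U` is not exceptional then some power of `U` is a noncentral element of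
the balls, namely `U` itself or its first return. -/
lemma exists_pow_mem_ballUnion_diff {U : SU d} (hU : ¬ HasExceptionalSpectrum U) :
    ∃ n, U ^ n ∈ ballUnion d ∧ U ^ n ∉ centreSU d := by
  by_cases hB : U ∈ ballUnion d \ centreSU d
  · exact ⟨1, by rwa [pow_one]⟩
  obtain ⟨h1, h2⟩ := returnTime_spec U
  refine ⟨returnTime U, h2, ?_⟩
  rintro ⟨a, ha, hUa⟩
  refine hU ⟨hB, returnTime U, h1, returnTime_le_maxReturnTime U, a, ha, fun z hz => ?_⟩
  have h3 := spectrum.pow_mem_pow (U : Matrix (Fin d) (Fin d) ℂ) (returnTime U) hz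
  have : Nonempty (Fin d) := by
    by_contra hemp
    rw [not_nonempty_iff] at hemp
    rw [spectrum.of_subsingleton] at hz
    exact hz
  rw [← SubmonoidClass.coe_pow, hUa, ← Algebra.algebraMap_eq_smul_one, spectrum.scalar_eq] at h3
  exact h3

end Recurrence

/-! ### Closed subgroups with irreducible adjoint action -/

/-- A closed subgroup of `SU(d)` with irreducible adjoint action and a noncentral element in the
balls is infinite; its Lie algebra is nonzero and invariant, hence all of `𝔰𝔲(d)`. -/
theorem eq_top_of_irreducible {d : ℕ} {H : Subgroup (SU d)} (hH : IsClosed (H : Set (SU d)))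
    (hirr : ∀ V : Submodule ℝ (su d), (∀ g ∈ H, ∀ x ∈ V, Ad g x ∈ V) → V = ⊥ ∨ V = ⊤)
    {g : SU d} (hgH : g ∈ H) (hg : g ∈ ballUnion d) (hgc : g ∉ centreSU d) : H = ⊤ := by
  have hinf : (H : Set (SU d)).Infinite := fun hfin =>
    hgc (mem_centreSU_of_finite hfin hirr hgH hg)
  refine eq_top_of_lieSubspace_eq_top (dim_ne_zero_of_not_mem_centreSU hgc) (hH := hH) ?_
  exact (hirr _ fun g hg x hx => Ad_mem_lieSubspace hH hg hx).resolve_left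
    (lieSubspace_ne_bot hH hinf)

theorem theorem1 (d n : ℕ) (U : Fin n → SU d)
    (X : Module.Basis (Fin (d ^ 2 - 1)) ℝ (su d))
    (hX : ∀ i j, suInner (X i) (X j) = if i = j then 1 else 0)
    (hC : Set.centralizer (Set.range fun i => AdMatrix X (U i)) =
      {L | ∃ c : ℝ, L = c • (1 : Matrix (Fin (d ^ 2 - 1)) (Fin (d ^ 2 - 1)) ℝ)})
    (hU : ∃ i, ¬ HasExceptionalSpectrum (U i)) :
    closure (Subsemigroup.closure (Set.range U) : Set (SU d)) = Set.univ := by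
  obtain ⟨i, hi⟩ := hU
  obtain ⟨m, hm, hmc⟩ := exists_pow_mem_ballUnion_diff hi
  have hsub : ∀ j, U j ∈ Subsemigroup.closure (Set.range U) := fun j =>
    Subsemigroup.subset_closure (Set.mem_range_self j)
  set H := closureSubgroup (Subsemigroup.closure (Set.range U)) ⟨U i, hsub i⟩ with hHdef
  have hUH : ∀ j, U j ∈ H := fun j => subset_closure (hsub j)
  have hH : IsClosed (H : Set (SU d)) := isClosed_closure
  have htop : H = ⊤ := eq_top_of_irreducible hH
    (fun V hV => eq_bot_or_eq_top_of_Ad_invariant hC (fun j => hV _ (hUH j))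
      (fun j => hV _ (H.inv_mem (hUH j)))) (H.pow_mem (hUH i) m) hm hmc
  exact congrArg (fun K : Subgroup (SU d) => (K : Set (SU d))) htop
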